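/- Let $K\ge 2$ and $d\ge 1$ be integers and let $S_1,\dots,S_K$ be real $d\times d$ matrices (not assumed nonsingular). For a switching law $\sigma:\{1,2,\dots\}\to\{1,\dots,K\}$ and an initial state $x_0\in\mathbb{R}^d$, let $x_n(x_0,\sigma)=S_{\sigma(n)}\cdots S_{\sigma(1)}x_0$ for $n\ge 1$. Call $\sigma$ fiber-chaotic if for every $x_0\in\mathbb{R}^d\setminus\{0\}$, $$\liminf_{n\to\infty}\|x_n(x_0,\sigma)\|=0\quad\text{and}\quad\limsup_{n\to\infty}\|x_n(x_0,\sigma)\|=\infty,$$ where $\|\cdot\|$ is the Euclidean norm. Suppose that the system is periodically stable, i.e. for every $\pi\ge 1$ and every word $(k_1,\dots,k_\pi)\in\{1,\dots,K\}^\pi$ the spectral radius (the largest modulus of a complex eigenvalue) of $S_{k_\pi}\cdots S_{k_1}$ is less than $1$. Then no switching law $\sigma$ is fiber-chaotic. -/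

import Mathlib

open Filter

noncomputable section

namespace LinearInclusion

/-- The matrix product `S_{k_π} ⋯ S_{k_1}` along the finite word `[k_1, …, k_π]`. -/
def wordProduct {K d : ℕ} (S : Fin K → Matrix (Fin d) (Fin d) ℝ) (w : List (Fin K)) :
    Matrix (Fin d) (Fin d) ℝ :=
  (w.map S).reverse.prod

/-- The usual spectral radius of a real square matrix: the largest modulus of its complex
eigenvalues. -/
def matrixSpectralRadius {d : ℕ} (A : Matrix (Fin d) (Fin d) ℝ) : ENNReal :=
  spectralRadius ℂ (A.map (algebraMap ℝ ℂ))

/-- The system is periodically stable: for every word of length at least one, the corresponding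
product has spectral radius less than `1`. -/
def PeriodicallyStable {K d : ℕ} (S : Fin K → Matrix (Fin d) (Fin d) ℝ) : Prop :=
  ∀ w : List (Fin K), w ≠ [] → matrixSpectralRadius (wordProduct S w) < 1

/-- The state trajectory `x_n = S_{σ(n)} ⋯ S_{σ(1)} x_0` governed by the switching law `σ`.
Switching laws are indexed from `0` here: the symbol applied at the step from `x_n` to `x_{n+1}`,
classically written `σ(n+1)`, is `σ n`. -/
def trajectory {K d : ℕ} (S : Fin K → Matrix (Fin d) (Fin d) ℝ) (σ : ℕ → Fin K)
    (x₀ : EuclideanSpace ℝ (Fin d)) : ℕ → EuclideanSpace ℝ (Fin d)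
  | 0 => x₀
  | n + 1 => Matrix.toEuclideanLin (S (σ n)) (trajectory S σ x₀ n)

/-- The switching law `σ` is fiber-chaotic: for every nonzero initial state, the Euclidean norms
along the trajectory have lower limit `0` and upper limit `∞` (both taken in `[0, ∞]`). -/
def FiberChaotic {K d : ℕ} (S : Fin K → Matrix (Fin d) (Fin d) ℝ) (σ : ℕ → Fin K) : Prop :=
  ∀ x₀ : EuclideanSpace ℝ (Fin d), x₀ ≠ 0 →
    liminf (fun n => ENNReal.ofReal ‖trajectory S σ x₀ n‖) atTop = 0 ∧
    limsup (fun n => ENNReal.ofReal ‖trajectory S σ x₀ n‖) atTop = ⊤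

end LinearInclusion

end

/-! On a minimal nonzero subspace `V` invariant under all `S i`, the monoid generated by the
restrictions acts irreducibly. Periodic stability bounds every trace on `V` by `dim V`.
Irreducibility makes the trace form nondegenerate on the algebra spanned by the monoid, so finitely
many functionals `tr(· h)`, with `h` in the monoid, control every matrix coefficient: bounded traces
force bounded orbits. Hence all trajectories starting in `V` stay bounded, which rules out an
infinite limsup. -/

/-! ### Irreducible monoids and the trace form -/

open Polynomial in
theorem LinearMap.exists_polynomial_isIdempotentElem_apply_eq {k V : Type*} [Field k]
    [AddCommGroup V] [Module k V] [FiniteDimensional k V] (T : Module.End k V) {v : V}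
    (hv : T v = v) :
    ∃ r : k[X], IsIdempotentElem (T * aeval T r) ∧ (T * aeval T r) v = v := by
  have hm : minpoly k T ≠ 0 := minpoly.ne_zero (Algebra.IsIntegral.isIntegral T)
  obtain ⟨g, hg, hndvd⟩ := exists_eq_pow_rootMultiplicity_mul_and_not_dvd (minpoly k T) hm 1
  set m := rootMultiplicity 1 (minpoly k T)
  have hirr : Irreducible (X - C (1 : k)) := irreducible_X_sub_C 1
  have hX : ¬ (X - C (1 : k)) ∣ X := by
    rw [dvd_iff_isRoot]; simp
  -- Bézout yields the projection onto the generalized 1-eigenspace. The extra factor `X`, harmless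
  -- since `1 ≠ 0`, makes this projection a multiple of `T`.
  have hcop : IsCoprime ((X - C (1 : k)) ^ m) (X * g) := by
    apply IsCoprime.pow_left
    exact IsCoprime.mul_right ((hirr.coprime_iff_not_dvd).2 hX)
      ((hirr.coprime_iff_not_dvd).2 hndvd)
  obtain ⟨a, b, hab⟩ := hcop
  have hTe : T * aeval T (g * b) = aeval T (b * (X * g)) := by
    rw [show b * (X * g) = X * (g * b) by ring, map_mul (aeval T) X, aeval_X]
  have hkill : aeval T (b * (X * g)) * aeval T (a * (X - C (1 : k)) ^ m) = 0 := by
    rw [← map_mul, show b * (X * g) * (a * (X - C (1 : k)) ^ m) =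
      (b * X * a) * ((X - C (1 : k)) ^ m * g) by ring, ← hg]
    simp
  have hsum : aeval T (a * (X - C (1 : k)) ^ m) + aeval T (b * (X * g)) = 1 := by
    rw [← map_add, hab, map_one]
  refine ⟨g * b, ?_, ?_⟩
  · rw [hTe, IsIdempotentElem]
    have := congrArg (fun t => aeval T (b * (X * g)) * t) hsum
    rwa [mul_add, hkill, zero_add, mul_one] at this
  · rw [hTe]
    by_cases h0 : v = 0
    · simp [h0]
    have hroot : m ≠ 0 := by
      have : (minpoly k T).IsRoot 1 :=
        Module.End.isRoot_of_hasEigenvalue (Module.End.hasEigenvalue_of_hasEigenvector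
          (x := v) ⟨by simp [hv], h0⟩)
      exact ((rootMultiplicity_pos hm).2 this).ne'
    have h1 : aeval T (a * (X - C (1 : k)) ^ m) v = 0 := by
      obtain ⟨j, hj⟩ := Nat.exists_eq_succ_of_ne_zero hroot
      rw [hj, pow_succ, ← mul_assoc, map_mul]
      simp [hv]
    have := congrArg (fun t : Module.End k V => t v) hsum
    rwa [LinearMap.add_apply, h1, zero_add] at this

/-- The trace form is nondegenerate on an algebra of operators acting irreducibly. -/
theorem Subalgebra.eq_zero_of_forall_trace_mul_eq_zero {k V : Type*} [Field k] [CharZero k]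
    [AddCommGroup V] [Module k V] [FiniteDimensional k V] (A : Subalgebra k (Module.End k V))
    (hA : ∀ W : Submodule k V, (∀ g ∈ A, ∀ w ∈ W, g w ∈ W) → W = ⊥ ∨ W = ⊤)
    {a : Module.End k V} (ha : a ∈ A) (htr : ∀ b ∈ A, LinearMap.trace k V (a * b) = 0) :
    a = 0 := by
  by_contra hne
  obtain ⟨v, hv⟩ : ∃ v, a v ≠ 0 := by
    by_contra! h
    exact hne (LinearMap.ext h)
  obtain ⟨b, hb, hbv⟩ : ∃ b ∈ A, b (a v) = v := by
    let W : Submodule k V := (Subalgebra.toSubmodule A).map (LinearMap.applyₗ (a v))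
    have hW : W = ⊤ := by
      refine (hA W ?_).resolve_left ?_
      · rintro g hg _ ⟨c, hc, rfl⟩
        exact ⟨g * c, A.mul_mem hg hc, rfl⟩
      · intro h
        have : a v ∈ W := ⟨1, A.one_mem, rfl⟩
        rw [h] at this
        exact hv (by simpa using this)
    have : v ∈ W := hW ▸ Submodule.mem_top
    obtain ⟨c, hc, h⟩ := this
    exact ⟨c, hc, h⟩
  obtain ⟨r, hid, hfix⟩ :=
    LinearMap.exists_polynomial_isIdempotentElem_apply_eq (b * a) (v := v) hbv
  have hmem : Polynomial.aeval (b * a) r ∈ A :=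
    Algebra.adjoin_le (Set.singleton_subset_iff.2 (A.mul_mem hb ha))
      (Polynomial.aeval_mem_adjoin_singleton k _)
  -- Cyclicity brings `a` to the front. The trace of this idempotent is its rank, yet it fixes `v ≠
  -- 0`.
  have h0 : LinearMap.trace k V (b * a * Polynomial.aeval (b * a) r) = 0 := by
    rw [mul_assoc, LinearMap.trace_mul_comm, mul_assoc]
    exact htr _ (A.mul_mem hmem hb)
  have hproj := (LinearMap.isProj_range_iff_isIdempotentElem _).2 hid
  rw [hproj.trace] at h0
  have hr : Module.finrank k (LinearMap.range (b * a * Polynomial.aeval (b * a) r)) = 0 := by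
    exact_mod_cast h0
  rw [Submodule.finrank_eq_zero] at hr
  have : v ∈ LinearMap.range (b * a * Polynomial.aeval (b * a) r) := ⟨v, hfix⟩
  rw [hr, Submodule.mem_bot] at this
  exact hv (by simp [this])

/-- An irreducible monoid of operators with bounded traces is bounded. -/
theorem Submonoid.exists_abs_dual_le_of_trace_le {V : Type*} [AddCommGroup V] [Module ℝ V]
    [FiniteDimensional ℝ V] (Γ : Submonoid (Module.End ℝ V))
    (hΓ : ∀ W : Submodule ℝ V, (∀ g ∈ Γ, ∀ w ∈ W, g w ∈ W) → W = ⊥ ∨ W = ⊤)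
    {C : ℝ} (hC : ∀ g ∈ Γ, |LinearMap.trace ℝ V g| ≤ C) (v : V) (l : V →ₗ[ℝ] ℝ) :
    ∃ B : ℝ, ∀ g ∈ Γ, |l (g v)| ≤ B := by
  let A : Subalgebra ℝ (Module.End ℝ V) := Algebra.adjoin ℝ (Γ : Set (Module.End ℝ V))
  have hAspan : Subalgebra.toSubmodule A = Submodule.span ℝ (Γ : Set (Module.End ℝ V)) := by
    rw [Algebra.adjoin_eq_span, Submonoid.closure_eq]
  have hA : ∀ W : Submodule ℝ V, (∀ g ∈ A, ∀ w ∈ W, g w ∈ W) → W = ⊥ ∨ W = ⊤ :=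
    fun W hW => hΓ W fun g hg => hW g (Algebra.subset_adjoin hg)
  let φ : Γ → Module.Dual ℝ A := fun g =>
    LinearMap.trace ℝ V ∘ₗ LinearMap.mulRight ℝ (g : Module.End ℝ V) ∘ₗ A.val.toLinearMap
  -- Functionals without a common nonzero zero span the dual.
  have hspan : Submodule.span ℝ (Set.range φ) = ⊤ := by
    refine Submodule.span_eq_top_of_ne_zero fun a ha => ?_
    by_contra! h
    refine ha (Subtype.ext (A.eq_zero_of_forall_trace_mul_eq_zero hA a.2 fun b hb => ?_))
    have hb' : b ∈ Submodule.span ℝ (Γ : Set (Module.End ℝ V)) := hAspan ▸ hb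
    induction hb' using Submodule.span_induction with
    | mem x hx => exact h _ ⟨⟨x, hx⟩, rfl⟩
    | zero => simp
    | add x y hx hy h1 h2 =>
      rw [mul_add, map_add, h1 (hAspan.symm ▸ hx :), h2 (hAspan.symm ▸ hy :), add_zero]
    | smul c x hx h1 => rw [mul_smul_comm, map_smul, h1 (hAspan.symm ▸ hx :), smul_zero]
  have hbdd : ∀ ψ : Module.Dual ℝ A, ∃ B : ℝ, ∀ g (hg : g ∈ Γ),
      |ψ ⟨g, Algebra.subset_adjoin hg⟩| ≤ B := by
    intro ψ
    have hψ : ψ ∈ Submodule.span ℝ (Set.range φ) := hspan ▸ Submodule.mem_top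
    induction hψ using Submodule.span_induction with
    | mem x hx =>
      obtain ⟨h, rfl⟩ := hx
      -- The bound is uniform in `g` because `g * h` is again in `Γ`.
      exact ⟨C, fun g hg => hC _ (Γ.mul_mem hg h.2)⟩
    | zero => exact ⟨0, by simp⟩
    | add x y _ _ h1 h2 =>
      obtain ⟨B₁, h1⟩ := h1
      obtain ⟨B₂, h2⟩ := h2
      exact ⟨B₁ + B₂, fun g hg => (abs_add_le _ _).trans (add_le_add (h1 g hg) (h2 g hg))⟩
    | smul c x _ h1 =>
      obtain ⟨B, h1⟩ := h1
      refine ⟨|c| * B, fun g hg => ?_⟩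
      rw [LinearMap.smul_apply, smul_eq_mul, abs_mul]
      exact mul_le_mul_of_nonneg_left (h1 g hg) (abs_nonneg c)
  exact hbdd (l ∘ₗ LinearMap.applyₗ v ∘ₗ A.val.toLinearMap)

theorem Submonoid.exists_norm_apply_le_of_trace_le {V : Type*} [NormedAddCommGroup V]
    [NormedSpace ℝ V] [FiniteDimensional ℝ V] (Γ : Submonoid (Module.End ℝ V))
    (hΓ : ∀ W : Submodule ℝ V, (∀ g ∈ Γ, ∀ w ∈ W, g w ∈ W) → W = ⊥ ∨ W = ⊤)
    {C : ℝ} (hC : ∀ g ∈ Γ, |LinearMap.trace ℝ V g| ≤ C) (v : V) :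
    ∃ B : ℝ, ∀ g ∈ Γ, ‖g v‖ ≤ B := by
  let b := Module.finBasis ℝ V
  choose B hB using fun i => Γ.exists_abs_dual_le_of_trace_le hΓ hC v (b.coord i)
  refine ⟨∑ i, B i * ‖b i‖, fun g hg => ?_⟩
  conv_lhs => rw [← b.sum_repr (g v)]
  refine (norm_sum_le _ _).trans (Finset.sum_le_sum fun i _ => ?_)
  rw [norm_smul]
  exact mul_le_mul_of_nonneg_right (hB i g hg) (norm_nonneg _)

/-! ### Trace bounds and minimal invariant subspaces -/

/-- If `f` is annihilated by a real polynomial whose complex roots lie in the closed unit disc,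
then the trace of `f` is bounded by the dimension. -/
theorem LinearMap.abs_trace_le_finrank {V : Type*} [AddCommGroup V] [Module ℝ V]
    [FiniteDimensional ℝ V] (f : Module.End ℝ V) (p : Polynomial ℝ)
    (hp : Polynomial.aeval f p = 0)
    (hroots : ∀ z : ℂ, (p.map (algebraMap ℝ ℂ)).IsRoot z → ‖z‖ ≤ 1) :
    |LinearMap.trace ℝ V f| ≤ Module.finrank ℝ V := by
  let b := Module.finBasis ℝ V
  let M := LinearMap.toMatrix b b f
  let N := M.map (algebraMap ℝ ℂ)
  have hM : Polynomial.aeval M p = 0 := by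
    have := Polynomial.aeval_algHom_apply (LinearMap.toMatrixAlgEquiv b).toAlgHom f p
    rw [hp, map_zero] at this
    exact this
  have hN : Polynomial.aeval N (p.map (algebraMap ℝ ℂ)) = 0 := by
    rw [Polynomial.aeval_map_algebraMap]
    have := Polynomial.aeval_algHom_apply ((Algebra.ofId ℝ ℂ).mapMatrix) M p
    rw [hM, map_zero] at this
    exact this
  have hspec : ∀ z ∈ N.charpoly.roots, ‖z‖ ≤ 1 := by
    intro z hz
    have hz' : z ∈ spectrum ℂ N :=
      Matrix.mem_spectrum_iff_isRoot_charpoly.2 (Polynomial.isRoot_of_mem_roots hz)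
    -- Spectral mapping: `p(z)` lies in the spectrum of `p(N) = 0`, so `z` is a root of `p`.
    have := spectrum.subset_polynomial_aeval N (p.map (algebraMap ℝ ℂ)) ⟨z, hz', rfl⟩
    rw [hN] at this
    have hne : Nontrivial (Matrix (Fin (Module.finrank ℝ V)) (Fin (Module.finrank ℝ V)) ℂ) := by
      by_contra h
      rw [not_nontrivial_iff_subsingleton] at h
      simp at hz'
    rw [spectrum.zero_eq] at this
    exact hroots z this
  have htr : (algebraMap ℝ ℂ) (LinearMap.trace ℝ V f) = N.charpoly.roots.sum := by
    rw [← Matrix.trace_eq_sum_roots_charpoly, LinearMap.trace_eq_matrix_trace ℝ b]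
    simp [N, M, Matrix.trace]
  have hnorm : ‖(algebraMap ℝ ℂ) (LinearMap.trace ℝ V f)‖ ≤ Module.finrank ℝ V := by
    rw [htr]
    refine (Multiset.le_sum_of_subadditive norm norm_zero.le norm_add_le _).trans ?_
    refine (Multiset.sum_le_card_nsmul _ 1 ?_).trans ?_
    · intro x hx
      obtain ⟨z, hz, rfl⟩ := Multiset.mem_map.1 hx
      exact hspec z hz
    · have := Polynomial.card_roots' N.charpoly
      rw [Matrix.charpoly_natDegree_eq_dim, Fintype.card_fin] at this
      simpa using this
  simpa using hnorm

theorem exists_minimal_invariant_submodule {k V ι : Type*} [DivisionRing k] [AddCommGroup V]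
    [Module k V] [FiniteDimensional k V] [Nontrivial V] (s : ι → Module.End k V) :
    ∃ W : Submodule k V, W ≠ ⊥ ∧ (∀ i, ∀ w ∈ W, s i w ∈ W) ∧
      ∀ U ≤ W, U ≠ ⊥ → (∀ i, ∀ u ∈ U, s i u ∈ U) → U = W := by
  obtain ⟨W, ⟨h1, h2⟩, hmin⟩ := (wellFounded_lt (α := Submodule k V)).has_min
    {W | W ≠ ⊥ ∧ ∀ i, ∀ w ∈ W, s i w ∈ W} ⟨⊤, top_ne_bot, fun _ _ _ => Submodule.mem_top⟩
  refine ⟨W, h1, h2, fun U hU h0 hs => ?_⟩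
  by_contra h
  exact hmin U ⟨h0, hs⟩ (lt_of_le_of_ne hU h)

/-! ### Application to switched systems -/

namespace LinearInclusion

theorem wordProduct_append {K d : ℕ} (S : Fin K → Matrix (Fin d) (Fin d) ℝ)
    (w w' : List (Fin K)) : wordProduct S (w ++ w') = wordProduct S w' * wordProduct S w := by
  simp [wordProduct]

/-- The bound is not strict because the empty word, needed for the unit of the monoid, gives the
identity matrix. -/
theorem PeriodicallyStable.norm_le_one_of_isRoot {K d : ℕ}
    {S : Fin K → Matrix (Fin d) (Fin d) ℝ} (hS : PeriodicallyStable S) (w : List (Fin K)) {z : ℂ}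
    (hz : ((wordProduct S w).charpoly.map (algebraMap ℝ ℂ)).IsRoot z) : ‖z‖ ≤ 1 := by
  rw [← Matrix.charpoly_map, ← Matrix.mem_spectrum_iff_isRoot_charpoly] at hz
  by_cases hw : w = []
  · subst hw
    have hne : Nontrivial (Matrix (Fin d) (Fin d) ℂ) := by
      by_contra h
      rw [not_nontrivial_iff_subsingleton] at h
      simp at hz
    have h1 : (algebraMap ℝ ℂ).mapMatrix (wordProduct S []) = 1 := by
      simp only [wordProduct, List.map_nil, List.reverse_nil, List.prod_nil, map_one]
    rw [RingHom.mapMatrix_apply] at h1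
    rw [h1, spectrum.one_eq, Set.mem_singleton_iff] at hz
    simp [hz]
  · have h : (‖z‖₊ : ENNReal) < 1 :=
      (le_iSup₂ (f := fun z _ => (‖z‖₊ : ENNReal)) z hz).trans_lt (hS w hw)
    have h' : ‖z‖₊ < 1 := by exact_mod_cast h
    exact_mod_cast h'.le

/-- Under periodic stability, some nonzero initial state has only bounded trajectories. -/
theorem PeriodicallyStable.exists_bounded_trajectory {K d : ℕ} (hd : 1 ≤ d)
    {S : Fin K → Matrix (Fin d) (Fin d) ℝ} (hS : PeriodicallyStable S) :
    ∃ x₀ : EuclideanSpace ℝ (Fin d), x₀ ≠ 0 ∧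
      ∃ B : ℝ, ∀ (σ : ℕ → Fin K) (n : ℕ), ‖trajectory S σ x₀ n‖ ≤ B := by
  have : Nonempty (Fin d) := ⟨⟨0, hd⟩⟩
  obtain ⟨V, hV0, hV, hmin⟩ :=
    exists_minimal_invariant_submodule (fun i => Matrix.toEuclideanLin (S i))
  let s : Fin K → Module.End ℝ V := fun i => (Matrix.toEuclideanLin (S i)).restrict (hV i)
  let Γ : Submonoid (Module.End ℝ V) := Submonoid.closure (Set.range s)
  have hword : ∀ g ∈ Γ, ∃ w : List (Fin K), ∀ v : V,
      ((g v : V) : EuclideanSpace ℝ (Fin d)) = Matrix.toEuclideanLin (wordProduct S w) v := by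
    intro g hg
    induction hg using Submonoid.closure_induction with
    | mem x hx =>
      obtain ⟨i, rfl⟩ := hx
      exact ⟨[i], fun v => by simp [wordProduct, s]⟩
    | one => exact ⟨[], fun v => by simp [wordProduct]⟩
    | mul x y _ _ hx hy =>
      obtain ⟨w, hw⟩ := hx
      obtain ⟨w', hw'⟩ := hy
      refine ⟨w' ++ w, fun v => ?_⟩
      rw [Module.End.mul_apply, hw, hw', wordProduct_append]
      simp [Matrix.toLpLin_apply]
  have hirr : ∀ W : Submodule ℝ V, (∀ g ∈ Γ, ∀ w ∈ W, g w ∈ W) → W = ⊥ ∨ W = ⊤ := by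
    intro W hW
    by_cases h0 : W = ⊥
    · exact Or.inl h0
    right
    have hmap : W.map V.subtype = V := by
      refine hmin _ (Submodule.map_subtype_le V W) ?_ ?_
      · intro h
        refine h0 (Submodule.map_injective_of_injective V.injective_subtype ?_)
        rw [h, Submodule.map_bot]
      · rintro i _ ⟨w, hw, rfl⟩
        exact ⟨s i w, hW _ (Submonoid.subset_closure ⟨i, rfl⟩) w hw, rfl⟩
    rw [eq_top_iff]
    intro v _
    have hv : (v : EuclideanSpace ℝ (Fin d)) ∈ W.map V.subtype := hmap.symm ▸ v.2
    obtain ⟨w, hw, hwv⟩ := hv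
    rwa [← Subtype.ext hwv]
  have htrace : ∀ g ∈ Γ, |LinearMap.trace ℝ V g| ≤ Module.finrank ℝ V := by
    intro g hg
    obtain ⟨w, hw⟩ := hword g hg
    -- By Cayley–Hamilton the characteristic polynomial of the full product also annihilates its
    -- restriction to `V`.
    refine LinearMap.abs_trace_le_finrank g (wordProduct S w).charpoly ?_
      fun z hz => hS.norm_le_one_of_isRoot w hz
    have hpow : ∀ p : Polynomial ℝ, ∀ v : V,
        ((Polynomial.aeval g p v : V) : EuclideanSpace ℝ (Fin d)) =
          Matrix.toEuclideanLin (Polynomial.aeval (wordProduct S w) p) v := by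
      intro p
      induction p using Polynomial.induction_on' with
      | add p q hp hq => intro v; simp [hp, hq]
      | monomial n a =>
        have hn : ∀ v : V, (((g ^ n) v : V) : EuclideanSpace ℝ (Fin d)) =
            Matrix.toEuclideanLin (wordProduct S w ^ n) v := by
          induction n with
          | zero => intro v; simp
          | succ n ih =>
            intro v
            rw [pow_succ, pow_succ, Module.End.mul_apply, ih, hw]
            simp [Matrix.toLpLin_apply]
        intro v
        simp only [Polynomial.aeval_monomial, ← Algebra.smul_def, LinearMap.smul_apply, map_smul,
          Submodule.coe_smul, hn]
    ext1 v
    apply Subtype.ext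
    rw [hpow, Matrix.aeval_self_charpoly]
    simp
  obtain ⟨x, hx, hx0⟩ := (Submodule.ne_bot_iff V).1 hV0
  obtain ⟨B, hB⟩ := Γ.exists_norm_apply_le_of_trace_le hirr htrace ⟨x, hx⟩
  refine ⟨x, hx0, B, fun σ n => ?_⟩
  obtain ⟨g, hg, hgx⟩ : ∃ g ∈ Γ, trajectory S σ x n = (g ⟨x, hx⟩ : V) := by
    induction n with
    | zero => exact ⟨1, Γ.one_mem, rfl⟩
    | succ n ih =>
      obtain ⟨g, hg, h⟩ := ih
      refine ⟨s (σ n) * g, Γ.mul_mem (Submonoid.subset_closure ⟨_, rfl⟩) hg, ?_⟩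
      rw [trajectory, h]
      rfl
  rw [hgx]
  exact hB g hg

end LinearInclusion

theorem theorem5p3 (K d : ℕ) (hK : 2 ≤ K) (hd : 1 ≤ d)
    (S : Fin K → Matrix (Fin d) (Fin d) ℝ) (hS : LinearInclusion.PeriodicallyStable S)
    (σ : ℕ → Fin K) :
    ¬ LinearInclusion.FiberChaotic S σ := by
  intro hσ
  obtain ⟨x₀, hx₀, B, hB⟩ := hS.exists_bounded_trajectory hd
  have hle : limsup (fun n => ENNReal.ofReal ‖LinearInclusion.trajectory S σ x₀ n‖) atTop
      ≤ ENNReal.ofReal B :=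
    limsup_le_of_le (h := Eventually.of_forall fun n => ENNReal.ofReal_le_ofReal (hB σ n))
  rw [(hσ x₀ hx₀).2] at hle
  exact ENNReal.ofReal_ne_top (top_le_iff.1 hle)
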